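/- A \emph{model} is a set or class $X$ such that $(X,\in)$ satisfies Extensionality, Foundation, Pairing, Union, Infinity, the Separation schema, Choice, and the existence of Cartesian products (so all $H_\theta$, $\theta$ an uncountable cardinal, and all $V_\lambda$, $\lambda>\omega$ a limit ordinal, are models). A set $x$ is \emph{bounded} in $X$ if $x\subseteq y$ for some $y\in X$, and \emph{guessed} in $X$ if $x\cap X=x^*\cap X$ for some $x^*\in X$. A \emph{powerful model} is a transitive model $\mathcal H$ (a set or a class) that contains every set bounded in $\mathcal H$. Let $\kappa_X$ be the least ordinal $\alpha\in X$ with $\alpha\nsubseteq X$, if there is one. Let $\delta$ be an infinite regular cardinal. A set $M$ is a \emph{$\delta$-guessing elementary submodel} if $M$ is a model for which $\kappa_M$ is defined, $\delta\in M$, $\delta\le\kappa_M$, $M$ is an elementary submodel of some powerful model, and every set $x$ that is bounded in $M$ and satisfies $x\cap a\in M$ for all $a\in M$ with $(M,\in)\models|a|<\delta$ is guessed in $M$. \textbf{Theorem.} Let $\kappa$ be a cardinal. If there is a $\delta$-guessing elementary submodel $M$ of size $\kappa<2^\delta$ with $\kappa\subseteq M$, then $\kappa<2^{<\delta}$, where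 $2^{<\delta}=\sup\{2^\mu:\mu<\delta\text{ a cardinal}\}$. In particular, for every infinite cardinal $\gamma$, if there is a $\gamma^+$-guessing elementary submodel $M$ of size $\gamma^+$ with $\gamma^+\subseteq M$, then $2^\gamma>\gamma^+$. -/

import Mathlib

open FirstOrder

universe u

/-- The only symbol of the language of set theory: a binary relation symbol. -/
inductive SetTheoryRel : ℕ → Type
  | mem : SetTheoryRel 2

/-- The first-order language `{∈}` of set theory. -/
def setTheoryLanguage : FirstOrder.Language.{0, 0} := ⟨fun _ => Empty, SetTheoryRel⟩

/-- A class `X` of sets, viewed as the first-order structure `(X, ∈)`. -/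
instance memStructure (X : Set ZFSet.{u}) : setTheoryLanguage.Structure X where
  funMap := fun f => Empty.elim f
  RelMap := fun r =>
    match r with
    | SetTheoryRel.mem => fun v => (v 0 : ZFSet.{u}) ∈ (v 1 : ZFSet.{u})

/-- `(X, ∈) ⊨ z = {x, y}`. -/
def SatUnorderedPair (X : Set ZFSet.{u}) (z x y : X) : Prop :=
  ∀ w : X, w.1 ∈ z.1 ↔ w = x ∨ w = y

/-- `(X, ∈) ⊨ z = (x, y)`, where `(x, y) = {{x}, {x, y}}`. -/
def SatPair (X : Set ZFSet.{u}) (z x y : X) : Prop :=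
  ∃ s t : X, SatUnorderedPair X s x x ∧ SatUnorderedPair X t x y ∧ SatUnorderedPair X z s t

/-- `(X, ∈) ⊨ f is an injective function from a to b`. -/
def SatInjection (X : Set ZFSet.{u}) (f a b : X) : Prop :=
  (∀ z : X, z.1 ∈ f.1 → ∃ x y : X, x.1 ∈ a.1 ∧ y.1 ∈ b.1 ∧ SatPair X z x y) ∧
  (∀ x : X, x.1 ∈ a.1 → ∃! y : X, ∃ z : X, z.1 ∈ f.1 ∧ SatPair X z x y) ∧
  (∀ x x' y z z' : X, z.1 ∈ f.1 → z'.1 ∈ f.1 → SatPair X z x y → SatPair X z' x' y → x = x')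

/-- `|a|^X < d`, for an element `d` of `X` that is an infinite cardinal in `X`: in `(X, ∈)` there
is an injection of `a` into an element of `d`. -/
def SatCardLT (X : Set ZFSet.{u}) (a d : X) : Prop :=
  ∃ b : X, b.1 ∈ d.1 ∧ ∃ f : X, SatInjection X f a b

/-- `X` is a model: `(X, ∈)` satisfies the fragment of ZFC listed here (everything except power
set and replacement, with existence of Cartesian products in place of the latter). It holds in
`H_θ` for every uncountable cardinal `θ` and in `V_λ` for every limit ordinal `λ > ω`. -/
structure IsSetModel (X : Set ZFSet.{u}) : Prop where
  extensionality : ∀ x y : X, (∀ z : X, z.1 ∈ x.1 ↔ z.1 ∈ y.1) → x = y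
  foundation : ∀ x : X, (∃ y : X, y.1 ∈ x.1) →
    ∃ y : X, y.1 ∈ x.1 ∧ ∀ z : X, z.1 ∈ y.1 → ¬ z.1 ∈ x.1
  pairing : ∀ x y : X, ∃ z : X, SatUnorderedPair X z x y
  union : ∀ x : X, ∃ u : X, ∀ z : X, z.1 ∈ u.1 ↔ ∃ y : X, y.1 ∈ x.1 ∧ z.1 ∈ y.1
  infinity : ∃ w : X, (∃ e : X, e.1 ∈ w.1 ∧ ∀ z : X, ¬ z.1 ∈ e.1) ∧
    ∀ x : X, x.1 ∈ w.1 → ∃ s : X, s.1 ∈ w.1 ∧ ∀ z : X, z.1 ∈ s.1 ↔ z.1 ∈ x.1 ∨ z = x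
  separation : ∀ (n : ℕ) (φ : setTheoryLanguage.Formula (Option (Fin n))) (p : Fin n → X) (a : X),
    ∃ b : X, ∀ x : X, x.1 ∈ b.1 ↔ x.1 ∈ a.1 ∧ φ.Realize (fun o => o.elim x p)
  product : ∀ a b : X, ∃ c : X, ∀ z : X,
    z.1 ∈ c.1 ↔ ∃ x y : X, x.1 ∈ a.1 ∧ y.1 ∈ b.1 ∧ SatPair X z x y
  choice : ∀ a : X, (∀ x : X, x.1 ∈ a.1 → ∃ z : X, z.1 ∈ x.1) →
    (∀ x y z : X, x.1 ∈ a.1 → y.1 ∈ a.1 → z.1 ∈ x.1 → z.1 ∈ y.1 → x = y) →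
    ∃ c : X, ∀ x : X, x.1 ∈ a.1 → ∃! z : X, z.1 ∈ x.1 ∧ z.1 ∈ c.1

/-- The set `x` is bounded in `X`. -/
def IsBoundedIn (x : ZFSet.{u}) (X : Set ZFSet.{u}) : Prop :=
  ∃ y ∈ X, x ⊆ y

/-- `H` is a powerful model: a transitive model (a set or a proper class) that contains every set
bounded in it. -/
structure IsPowerfulModel (H : Set ZFSet.{u}) : Prop where
  model : IsSetModel H
  transitive : ∀ y ∈ H, ∀ x ∈ y, x ∈ H
  mem_of_bounded : ∀ x : ZFSet.{u}, IsBoundedIn x H → x ∈ H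

/-- `(M, ∈)` is an elementary submodel of `(H, ∈)`: the inclusion is an elementary embedding. -/
def IsElementarySubmodel (M H : Set ZFSet.{u}) : Prop :=
  ∃ j : M ↪ₑ[setTheoryLanguage] H, ∀ x : M, (j x : ZFSet.{u}) = x

/-- `α` is `κ_X`, the least ordinal that is an element but not a subset of `X`. -/
def IsKappa (X : Set ZFSet.{u}) (α : Ordinal.{u}) : Prop :=
  IsLeast {β : Ordinal.{u} | β.toZFSet ∈ X ∧ ¬ ∀ x ∈ β.toZFSet, x ∈ X} α

/-- The set `x` is guessed in `X`. -/
def IsGuessedIn (x : ZFSet.{u}) (X : Set ZFSet.{u}) : Prop :=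
  ∃ y ∈ X, (y : Set ZFSet.{u}) ∩ X = (x : Set ZFSet.{u}) ∩ X

/-- The set `x` is `d`-approximated in `M`, where `d ∈ M` is a cardinal:
`x ∩ a ∈ M` for every `a ∈ M` with `|a|^M < d`. -/
def IsApproximatedIn (x : ZFSet.{u}) (M : Set ZFSet.{u}) (d : M) : Prop :=
  ∀ a : M, SatCardLT M a d → x ∩ a.1 ∈ M

/-- `M` has the `d`-guessing property in `N`, where `d ∈ M` is a cardinal. -/
def HasGuessingPropertyIn (M N : Set ZFSet.{u}) (d : M) : Prop :=
  ∀ x ∈ N, IsBoundedIn x M → IsApproximatedIn x M d → IsGuessedIn x M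

/-- `M` is a `δ`-guessing elementary submodel: a model with `κ_M` defined, with `δ ∈ M` a regular
cardinal, `δ ≤ κ_M`, that is an elementary submodel of some powerful model and has the
`δ`-guessing property in the universe of all sets. -/
structure IsGuessingElementarySubmodel (M : Set ZFSet.{u}) (δ : Cardinal.{u}) : Prop where
  model : IsSetModel M
  regular : δ.IsRegular
  le_kappa : ∃ α : Ordinal.{u}, IsKappa M α ∧ δ.ord ≤ α
  elementary : ∃ H : Set ZFSet.{u}, IsPowerfulModel H ∧ IsElementarySubmodel M H
  guessing : ∃ h : δ.ord.toZFSet ∈ M, HasGuessingPropertyIn M Set.univ ⟨δ.ord.toZFSet, h⟩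

/-! If `κ < δ`, Cantor gives `κ < 2 ^ κ ≤ 2 ^< δ`. Otherwise `δ ⊆ M`; supposing `2 ^< δ ≤ κ`, every
subset of `δ` lies in `M`, so `2 ^ δ ≤ κ`, a contradiction. For bounded subsets this is
`IsElementarySubmodel.subset_mem`: for `o < δ` the subsets of `o` can be enumerated along an ordinal
in `M`; by elementarity the least such ordinal is at most `κ ⊆ M`, so all indices, hence all rows,
are in `M`. For arbitrary `x ⊆ δ`, if `a ∈ M` is small in `M` then `δ ∩ a` has size below `δ`
(`card_inter_le_of_satInjection`), so it is bounded by regularity and `x ∩ a ∈ M`. Guessing then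
puts `x` in `M`. -/

/-! ### Formulas of set theory and their meaning in `(X, ∈)`. -/

open FirstOrder.Language in
/-- The atomic formula `xᵢ ∈ xⱼ`. -/
def memFormula {n : ℕ} (i j : Fin n) : setTheoryLanguage.BoundedFormula Empty n :=
  Relations.boundedFormula₂ (L := setTheoryLanguage) SetTheoryRel.mem (&i) (&j)

open FirstOrder.Language in
/-- The atomic formula `xᵢ = xⱼ`. -/
def eqFormula {n : ℕ} (i j : Fin n) : setTheoryLanguage.BoundedFormula Empty n :=
  Term.bdEqual (&i) (&j)

/-- The formula `z = {x, y}`. -/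
def unorderedPairFormula {n : ℕ} (z x y : Fin n) : setTheoryLanguage.BoundedFormula Empty n :=
  ((memFormula (Fin.last n) z.castSucc).iff
    (eqFormula (Fin.last n) x.castSucc ⊔ eqFormula (Fin.last n) y.castSucc)).all

/-- The formula `z = (x, y)`. -/
def pairFormula {n : ℕ} (z x y : Fin n) : setTheoryLanguage.BoundedFormula Empty n :=
  (unorderedPairFormula (Fin.last n).castSucc x.castSucc.castSucc x.castSucc.castSucc ⊓
    (unorderedPairFormula (Fin.last (n + 1)) x.castSucc.castSucc y.castSucc.castSucc ⊓
      unorderedPairFormula z.castSucc.castSucc (Fin.last n).castSucc (Fin.last (n + 1)))).ex.ex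

/-- The formula `(x, y) ∈ r`. -/
def pairMemFormula {n : ℕ} (r x y : Fin n) : setTheoryLanguage.BoundedFormula Empty n :=
  (memFormula (Fin.last n) r.castSucc ⊓
    pairFormula (Fin.last n) x.castSucc y.castSucc).ex

/-- `(X, ∈) ⊨ (x, y) ∈ r`. -/
def SatPairMem (X : Set ZFSet.{u}) (r x y : X) : Prop :=
  ∃ z : X, z.1 ∈ r.1 ∧ SatPair X z x y

/-- `(X, ∈) ⊨` every subset of `m` is a row of the relation `r` with index in `l`. -/
def SatEnumerates (X : Set ZFSet.{u}) (l m r : X) : Prop :=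
  ∀ x : X, (∀ w : X, w.1 ∈ x.1 → w.1 ∈ m.1) →
    ∃ i : X, i.1 ∈ l.1 ∧ ∀ w : X, w.1 ∈ x.1 ↔ w.1 ∈ m.1 ∧ SatPairMem X r i w

/-- The formula expressing `SatEnumerates`. -/
def enumeratesFormula {n : ℕ} (l m r : Fin n) : setTheoryLanguage.BoundedFormula Empty n :=
  (((memFormula (Fin.last (n + 1)) (Fin.last n).castSucc).imp
      (memFormula (Fin.last (n + 1)) m.castSucc.castSucc)).all.imp
    (memFormula (Fin.last (n + 1)) l.castSucc.castSucc ⊓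
      ((memFormula (Fin.last (n + 2)) (Fin.last n).castSucc.castSucc).iff
        (memFormula (Fin.last (n + 2)) m.castSucc.castSucc.castSucc ⊓
          pairMemFormula r.castSucc.castSucc.castSucc (Fin.last (n + 1)).castSucc
            (Fin.last (n + 2)))).all).ex).all

section Realize

variable {X : Set ZFSet.{u}} {n : ℕ} {e : Empty → X} {v : Fin n → X}

@[simp]
theorem realize_memFormula {i j : Fin n} :
    (memFormula i j).Realize e v ↔ (v i).1 ∈ (v j).1 := by
  exact Iff.rfl

@[simp]
theorem realize_eqFormula {i j : Fin n} : (eqFormula i j).Realize e v ↔ v i = v j := by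
  rw [eqFormula, Language.BoundedFormula.realize_bdEqual]
  rfl

@[simp]
theorem realize_unorderedPairFormula {z x y : Fin n} :
    (unorderedPairFormula z x y).Realize e v ↔ SatUnorderedPair X (v z) (v x) (v y) := by
  simp [unorderedPairFormula, SatUnorderedPair]

@[simp]
theorem realize_pairFormula {z x y : Fin n} :
    (pairFormula z x y).Realize e v ↔ SatPair X (v z) (v x) (v y) := by
  simp [pairFormula, SatPair]

@[simp]
theorem realize_pairMemFormula {r x y : Fin n} :
    (pairMemFormula r x y).Realize e v ↔ SatPairMem X (v r) (v x) (v y) := by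
  simp [pairMemFormula, SatPairMem]

@[simp]
theorem realize_enumeratesFormula {l m r : Fin n} :
    (enumeratesFormula l m r).Realize e v ↔ SatEnumerates X (v l) (v m) (v r) := by
  simp [enumeratesFormula, SatEnumerates]

end Realize

/-! ### Reflecting witnesses into an elementary submodel. -/

section Elementary

variable {M H : Set ZFSet.{u}}

theorem IsElementarySubmodel.subset (h : IsElementarySubmodel M H) : M ⊆ H := by
  obtain ⟨j, hj⟩ := h
  intro x hx
  have h := (j ⟨x, hx⟩).2
  rwa [hj] at h

/-- The Tarski–Vaught property of an elementary submodel. -/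
theorem IsElementarySubmodel.exists_mem (h : IsElementarySubmodel M H) {n : ℕ}
    (φ : setTheoryLanguage.BoundedFormula Empty (n + 1)) (p : Fin n → H)
    (hp : ∀ i, (p i).1 ∈ M) {y : H} (hy : φ.Realize Empty.elim (Fin.snoc p y)) :
    ∃ y : H, y.1 ∈ M ∧ φ.Realize Empty.elim (Fin.snoc p y) := by
  obtain ⟨j, hj⟩ := h
  have hq : p = j ∘ fun i => (⟨p i, hp i⟩ : M) := by
    funext i
    exact Subtype.ext (hj ⟨p i, hp i⟩).symm
  have hex : φ.ex.Realize (j ∘ Empty.elim) p := by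
    rw [Language.BoundedFormula.realize_ex]
    exact ⟨y, by convert hy⟩
  rw [hq, j.map_boundedFormula, Language.BoundedFormula.realize_ex] at hex
  obtain ⟨z, hz⟩ := hex
  refine ⟨j z, by rw [hj]; exact z.2, ?_⟩
  rw [← j.map_boundedFormula] at hz
  rw [hq]
  rw [← Fin.comp_snoc]
  convert hz

/-- Only the index has to be reflected into `M`: the enumeration is quantified inside the formula,
and the index `i` is the witness rather than a parameter, so it need not start in `M`. -/
theorem IsElementarySubmodel.exists_index (h : IsElementarySubmodel M H) {l m i r : H}
    (hl : l.1 ∈ M) (hm : m.1 ∈ M) (hi : i.1 ∈ l.1) (hr : SatEnumerates H i m r) :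
    ∃ i r : H, i.1 ∈ M ∧ i.1 ∈ l.1 ∧ SatEnumerates H i m r := by
  obtain ⟨i', hi', h'⟩ := h.exists_mem (n := 2)
    (memFormula 2 0 ⊓ (enumeratesFormula 2 1 3).ex) ![l, m]
    (by simp [Fin.forall_fin_two, hl, hm]) (y := i)
    (by
      rw [Language.BoundedFormula.realize_inf, Language.BoundedFormula.realize_ex]
      exact ⟨realize_memFormula.2 hi, r, realize_enumeratesFormula.2 hr⟩)
  rw [Language.BoundedFormula.realize_inf, Language.BoundedFormula.realize_ex] at h'
  obtain ⟨h₁, r', h₂⟩ := h'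
  exact ⟨i', r', hi', realize_memFormula.1 h₁, realize_enumeratesFormula.1 h₂⟩

theorem IsElementarySubmodel.exists_enumeration (h : IsElementarySubmodel M H) {l m r : H}
    (hl : l.1 ∈ M) (hm : m.1 ∈ M) (hr : SatEnumerates H l m r) :
    ∃ r : H, r.1 ∈ M ∧ SatEnumerates H l m r := by
  obtain ⟨r', hr', h'⟩ := h.exists_mem (n := 2) (enumeratesFormula 0 1 2) ![l, m]
    (by simp [Fin.forall_fin_two, hl, hm]) (y := r) (realize_enumeratesFormula.2 hr)
  exact ⟨r', hr', realize_enumeratesFormula.1 h'⟩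

theorem IsElementarySubmodel.exists_row (h : IsElementarySubmodel M H) {m r i x : H}
    (hm : m.1 ∈ M) (hr : r.1 ∈ M) (hi : i.1 ∈ M)
    (hx : ∀ w : H, w.1 ∈ x.1 ↔ w.1 ∈ m.1 ∧ SatPairMem H r i w) :
    ∃ x : H, x.1 ∈ M ∧ ∀ w : H, w.1 ∈ x.1 ↔ w.1 ∈ m.1 ∧ SatPairMem H r i w := by
  have key : ∀ y : H, ((memFormula 4 3).iff (memFormula 4 0 ⊓ pairMemFormula 1 2 4)).all.Realize
      Empty.elim (Fin.snoc ![m, r, i] y : Fin 4 → H) ↔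
      ∀ w : H, w.1 ∈ y.1 ↔ w.1 ∈ m.1 ∧ SatPairMem H r i w := by
    intro y
    simp only [Language.BoundedFormula.realize_all, Language.BoundedFormula.realize_iff,
      Language.BoundedFormula.realize_inf, realize_memFormula, realize_pairMemFormula]
    rfl
  obtain ⟨x', hx', h'⟩ := h.exists_mem (n := 3) _ ![m, r, i]
    (by simp [Fin.forall_fin_succ, hm, hr, hi]) ((key x).2 hx)
  exact ⟨x', hx', (key x').1 h'⟩

theorem IsElementarySubmodel.exists_inter (h : IsElementarySubmodel M H) {a b x : H}
    (ha : a.1 ∈ M) (hb : b.1 ∈ M) (hx : ∀ w : H, w.1 ∈ x.1 ↔ w.1 ∈ a.1 ∧ w.1 ∈ b.1) :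
    ∃ x : H, x.1 ∈ M ∧ ∀ w : H, w.1 ∈ x.1 ↔ w.1 ∈ a.1 ∧ w.1 ∈ b.1 := by
  have key : ∀ y : H, ((memFormula 3 2).iff (memFormula 3 0 ⊓ memFormula 3 1)).all.Realize
      Empty.elim (Fin.snoc ![a, b] y : Fin 3 → H) ↔
      ∀ w : H, w.1 ∈ y.1 ↔ w.1 ∈ a.1 ∧ w.1 ∈ b.1 := by
    intro y
    simp only [Language.BoundedFormula.realize_all, Language.BoundedFormula.realize_iff,
      Language.BoundedFormula.realize_inf, realize_memFormula]
    rfl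
  obtain ⟨x', hx', h'⟩ := h.exists_mem (n := 2) _ ![a, b]
    (by simp [Fin.forall_fin_two, ha, hb]) ((key x).2 hx)
  exact ⟨x', hx', (key x').1 h'⟩

end Elementary

open Cardinal Ordinal

/-! ### Absoluteness and enumerations of power sets in powerful models. -/

section Powerful

variable {H : Set ZFSet.{u}}

theorem satUnorderedPair_iff (hH : ∀ y ∈ H, ∀ x ∈ y, x ∈ H) {z x y : H} :
    SatUnorderedPair H z x y ↔ z.1 = {x.1, y.1} := by
  constructor
  · intro h
    ext w
    rw [ZFSet.mem_pair]
    constructor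
    · intro hw
      simpa [Subtype.ext_iff] using (h ⟨w, hH _ z.2 _ hw⟩).1 hw
    · rintro (rfl | rfl)
      · exact (h x).2 (.inl rfl)
      · exact (h y).2 (.inr rfl)
  · intro h w
    rw [h, ZFSet.mem_pair, Subtype.ext_iff, Subtype.ext_iff]

theorem satPair_iff (hH : IsPowerfulModel H) {z x y : H} :
    SatPair H z x y ↔ z.1 = ZFSet.pair x.1 y.1 := by
  simp only [SatPair, satUnorderedPair_iff hH.transitive]
  constructor
  · rintro ⟨s, t, hs, ht, hz⟩
    rw [hz, hs, ht, ZFSet.pair, ZFSet.pair_eq_singleton]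
  · intro hz
    obtain ⟨s, hs⟩ := hH.model.pairing x x
    obtain ⟨t, ht⟩ := hH.model.pairing x y
    rw [satUnorderedPair_iff hH.transitive] at hs ht
    refine ⟨s, t, hs, ht, ?_⟩
    rw [hz, hs, ht, ZFSet.pair, ZFSet.pair_eq_singleton]

theorem IsPowerfulModel.pair_mem (hH : IsPowerfulModel H) {x y : ZFSet.{u}} (hx : x ∈ H)
    (hy : y ∈ H) : ZFSet.pair x y ∈ H := by
  obtain ⟨s, hs⟩ := hH.model.pairing ⟨x, hx⟩ ⟨x, hx⟩
  obtain ⟨t, ht⟩ := hH.model.pairing ⟨x, hx⟩ ⟨y, hy⟩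
  obtain ⟨z, hz⟩ := hH.model.pairing s t
  have h : SatPair H z ⟨x, hx⟩ ⟨y, hy⟩ := ⟨s, t, hs, ht, hz⟩
  rw [satPair_iff hH] at h
  exact h ▸ z.2

theorem IsPowerfulModel.prod_mem (hH : IsPowerfulModel H) {x y : ZFSet.{u}} (hx : x ∈ H)
    (hy : y ∈ H) : ZFSet.prod x y ∈ H := by
  obtain ⟨c, hc⟩ := hH.model.product ⟨x, hx⟩ ⟨y, hy⟩
  refine hH.mem_of_bounded _ ⟨c, c.2, fun z hz => ?_⟩
  obtain ⟨a, ha, b, hb, rfl⟩ := ZFSet.mem_prod.1 hz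
  have haH := hH.transitive _ hx _ ha
  have hbH := hH.transitive _ hy _ hb
  exact (hc ⟨_, hH.pair_mem haH hbH⟩).2 ⟨⟨a, haH⟩, ⟨b, hbH⟩, ha, hb, (satPair_iff hH).2 rfl⟩

theorem satPairMem_iff (hH : IsPowerfulModel H) {r x y : H} :
    SatPairMem H r x y ↔ ZFSet.pair x.1 y.1 ∈ r.1 := by
  simp only [SatPairMem, satPair_iff hH]
  constructor
  · rintro ⟨z, hz, h⟩
    exact h ▸ hz
  · intro h
    exact ⟨⟨_, hH.transitive _ r.2 _ h⟩, h, rfl⟩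

/-- An injection of the power set of `m` into `l` is coded by the pairs `(f x, w)` with `w ∈ x`.
This relation is a subset of `l × m`, hence bounded in `H`, so neither the injection nor the power
set has to belong to `H`. -/
theorem IsPowerfulModel.exists_satEnumerates (hH : IsPowerfulModel H) {l m : H}
    (h : (2 : Cardinal.{u}) ^ m.1.card ≤ l.1.card) : ∃ r : H, SatEnumerates H l m r := by
  rw [← ZFSet.card_powerset] at h
  obtain ⟨e⟩ : #(Shrink.{u} (ZFSet.powerset m.1)) ≤ #(Shrink.{u} l.1) := h
  let f : ZFSet.powerset m.1 ↪ l.1 :=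
    ((equivShrink _).toEmbedding.trans e).trans (equivShrink _).symm.toEmbedding
  let r : ZFSet.{u} := (ZFSet.prod l.1 m.1).sep fun z =>
    ∃ (x : ZFSet.powerset m.1) (w : ZFSet.{u}), w ∈ x.1 ∧ z = ZFSet.pair (f x).1 w
  have hr : r ∈ H := hH.mem_of_bounded _ ⟨_, hH.prod_mem l.2 m.2, ZFSet.sep_subset⟩
  refine ⟨⟨r, hr⟩, fun x hx => ?_⟩
  have hxm : x.1 ⊆ m.1 := fun w hw => hx ⟨w, hH.transitive _ x.2 _ hw⟩ hw
  let x' : ZFSet.powerset m.1 := ⟨x.1, ZFSet.mem_powerset.2 hxm⟩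
  refine ⟨⟨f x', hH.transitive _ l.2 _ (f x').2⟩, (f x').2, fun w => ?_⟩
  rw [satPairMem_iff hH]
  constructor
  · intro hw
    refine ⟨hxm hw, ?_⟩
    change _ ∈ r
    rw [ZFSet.mem_sep, ZFSet.pair_mem_prod]
    exact ⟨⟨(f x').2, hxm hw⟩, x', w.1, hw, rfl⟩
  · rintro ⟨-, hw⟩
    change _ ∈ r at hw
    rw [ZFSet.mem_sep] at hw
    obtain ⟨-, y, v, hv, hp⟩ := hw
    obtain ⟨h₁, rfl⟩ := ZFSet.pair_inj.1 hp
    rw [← f.injective (Subtype.ext h₁)] at hv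
    exact hv

theorem IsElementarySubmodel.inter_mem {M : Set ZFSet.{u}} (hM : IsElementarySubmodel M H)
    (hH : IsPowerfulModel H) {a b : ZFSet.{u}} (ha : a ∈ M) (hb : b ∈ M) : a ∩ b ∈ M := by
  have hMH := hM.subset
  have hab : a ∩ b ∈ H :=
    hH.mem_of_bounded _ ⟨a, hMH ha, fun z hz => (ZFSet.mem_inter.1 hz).1⟩
  obtain ⟨x, hxM, hx⟩ := hM.exists_inter (a := ⟨a, hMH ha⟩) (b := ⟨b, hMH hb⟩) (x := ⟨_, hab⟩)
    ha hb fun w => ZFSet.mem_inter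
  suffices a ∩ b = x.1 from this ▸ hxM
  ext w
  rw [ZFSet.mem_inter]
  exact ⟨fun hw => (hx ⟨w, hH.transitive _ (hMH ha) _ hw.1⟩).2 hw,
    fun hw => (hx ⟨w, hH.transitive _ x.2 _ hw⟩).1 hw⟩

/-- If the least ordinal in `M` that enumerates the subsets of `m` were larger than `k`, then
elementarity would produce a smaller one in `M`. -/
theorem IsElementarySubmodel.subset_mem {M : Set ZFSet.{u}} (hM : IsElementarySubmodel M H)
    (hH : IsPowerfulModel H) {k l : Ordinal.{u}} (hkM : ∀ x ∈ k.toZFSet, x ∈ M)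
    (hl : l.toZFSet ∈ M) (hkl : k ≤ l) {m : ZFSet.{u}} (hm : m ∈ M)
    (hmk : (2 : Cardinal.{u}) ^ m.card ≤ k.card) {x : ZFSet.{u}} (hx : x ⊆ m) : x ∈ M := by
  have hMH := hM.subset
  have hkH : k.toZFSet ∈ H :=
    hH.mem_of_bounded _ ⟨_, hMH hl, toZFSet_subset_toZFSet_iff.2 hkl⟩
  let S : Set Ordinal.{u} :=
    {o | ∃ i r : H, i.1 = o.toZFSet ∧ i.1 ∈ M ∧ SatEnumerates H i ⟨m, hMH hm⟩ r}
  have hS : S.Nonempty := by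
    obtain ⟨r, hr⟩ := hH.exists_satEnumerates (l := ⟨_, hMH hl⟩) (m := ⟨m, hMH hm⟩)
      (by simpa using hmk.trans (Ordinal.card_le_card hkl))
    exact ⟨l, _, r, rfl, hl, hr⟩
  obtain ⟨i, r, hi, hiM, hr⟩ := csInf_mem hS
  have hik : sInf S ≤ k := by
    by_contra! hlt
    obtain ⟨r', hr'⟩ := hH.exists_satEnumerates (l := ⟨_, hkH⟩) (m := ⟨m, hMH hm⟩)
      (by simpa using hmk)
    -- `k` itself need not be in `M`; it only witnesses in `H` that some element of `i` enumerates
    -- the subsets of `m`, and elementarity moves such a witness into `M`, below the minimum.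
    obtain ⟨i', r', hi'M, hi', h'⟩ := hM.exists_index (l := i) (i := ⟨_, hkH⟩) hiM hm
      (by rw [hi]; exact toZFSet_mem_toZFSet_iff.2 hlt) hr'
    rw [hi, mem_toZFSet_iff] at hi'
    obtain ⟨o, ho, hoi⟩ := hi'
    exact notMem_of_lt_csInf' ho ⟨i', r', hoi.symm, hi'M, h'⟩
  obtain ⟨r', hr'M, hr'⟩ := hM.exists_enumeration hiM hm hr
  have hxH : x ∈ H := hH.mem_of_bounded _ ⟨m, hMH hm, hx⟩
  obtain ⟨ι, hι, hrow⟩ := hr' ⟨x, hxH⟩ fun w hw => hx hw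
  have hιM : ι.1 ∈ M := hkM _ (toZFSet_subset_toZFSet_iff.2 hik (hi ▸ hι))
  obtain ⟨y, hyM, hy⟩ := hM.exists_row hm hr'M hιM hrow
  suffices x = y.1 from this ▸ hyM
  ext w
  constructor
  · exact fun hw => (hy ⟨w, hH.transitive _ hxH _ hw⟩).2 ((hrow _).1 hw)
  · exact fun hw => (hrow ⟨w, hH.transitive _ y.2 _ hw⟩).2 ((hy _).1 hw)

end Powerful

/-! ### Small sets in `M` and the guessing argument. -/

/-- A set of ordinals below a regular cardinal `δ` that has fewer than `δ` elements is bounded. -/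
theorem Cardinal.IsRegular.exists_subset_toZFSet {δ : Cardinal.{u}} (hδ : δ.IsRegular)
    {y : ZFSet.{u}} (hy : y ⊆ δ.ord.toZFSet) (hc : y.card < δ) :
    ∃ o < δ.ord, y ⊆ o.toZFSet := by
  let f : Shrink.{u} y → Ordinal.{u} := fun z => ((equivShrink y).symm z).1.rank
  refine ⟨⨆ z, f z + 1, Ordinal.iSup_add_one_lt_of_lt_cof (by rwa [hδ.cof_ord]) fun z => ?_,
    fun z hz => ?_⟩
  · obtain ⟨o, ho, h⟩ := mem_toZFSet_iff.1 (hy ((equivShrink y).symm z).2)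
    simpa only [f, ← h, rank_toZFSet] using ho
  · obtain ⟨o, -, rfl⟩ := mem_toZFSet_iff.1 (hy hz)
    rw [toZFSet_mem_toZFSet_iff, ← Order.add_one_le_iff]
    have := Ordinal.le_iSup (fun z => f z + 1) (equivShrink y ⟨_, hz⟩)
    simpa [f] using this

/-- `M` need not be transitive, so pairs in the sense of `M` are recognised by passing to the
transitive `H`. -/
theorem IsElementarySubmodel.eq_pair {M H : Set ZFSet.{u}} (hM : IsElementarySubmodel M H)
    (hH : IsPowerfulModel H) {z x y : M} (h : SatPair M z x y) : z.1 = ZFSet.pair x.1 y.1 := by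
  obtain ⟨j, hj⟩ := hM
  have h' : (pairFormula 0 1 2).Realize (Empty.elim : Empty → M) ![z, x, y] :=
    realize_pairFormula.2 h
  rw [← j.map_boundedFormula, realize_pairFormula, satPair_iff hH] at h'
  simpa [hj] using h'

/-- The injection in `M` acts only on elements of `a` that lie in `M`; intersecting with `d ⊆ M`
leaves only those. -/
theorem card_inter_le_of_satInjection {M H : Set ZFSet.{u}} (hM : IsElementarySubmodel M H)
    (hH : IsPowerfulModel H) {f a b : M} (h : SatInjection M f a b)
    {d : ZFSet.{u}} (hd : ∀ x ∈ d, x ∈ M) : (d ∩ a.1).card ≤ b.1.card := by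
  obtain ⟨hf, hex, hinj⟩ := h
  have key : ∀ x : Shrink.{u} (d ∩ a.1 : ZFSet.{u}), ∃ y : Shrink.{u} b.1, ∃ x' y' z : M,
      x'.1 = ((equivShrink _).symm x).1 ∧ y'.1 = ((equivShrink _).symm y).1 ∧ z.1 ∈ f.1 ∧
        SatPair M z x' y' := by
    intro x
    have hx := ZFSet.mem_inter.1 ((equivShrink _).symm x).2
    obtain ⟨y, ⟨z, hz, hp⟩, -⟩ := hex ⟨_, hd _ hx.1⟩ hx.2
    -- Totality does not say that the value is in `b`; this comes from decomposing the same pair by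
    -- `hf`.
    obtain ⟨x₁, y₁, hx₁, hy₁, hp₁⟩ := hf z hz
    obtain ⟨-, hyy⟩ := ZFSet.pair_inj.1 ((hM.eq_pair hH hp₁).symm.trans (hM.eq_pair hH hp))
    exact ⟨equivShrink _ ⟨y.1, hyy ▸ hy₁⟩, ⟨_, hd _ hx.1⟩, y, z, rfl, by simp, hz, hp⟩
  choose g x' y' z hx' hy' hz hp using key
  refine mk_le_of_injective (f := g) fun x₁ x₂ h => ?_
  have hy : y' x₁ = y' x₂ := Subtype.ext (by rw [hy', hy', h])
  have := hinj _ _ _ _ _ (hz x₁) (hz x₂) (hp x₁) (hy ▸ hp x₂)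
  apply (equivShrink _).symm.injective
  apply Subtype.ext
  rw [← hx', ← hx', this]

/-- All subsets of `δ` belong to `M` once `2 ^< δ` is at most the size of `M`. -/
theorem IsGuessingElementarySubmodel.two_power_le {M : ZFSet.{u}} {δ : Cardinal.{u}}
    (hM : IsGuessingElementarySubmodel (M : Set ZFSet.{u}) δ)
    (hsub : M.card.ord.toZFSet ⊆ M) (hδ : δ ≤ M.card)
    (h : Cardinal.powerlt 2 δ ≤ M.card) : 2 ^ δ ≤ M.card := by
  obtain ⟨H, hH, hMH⟩ := hM.elementary
  obtain ⟨α, ⟨⟨hαM, hα⟩, -⟩, -⟩ := hM.le_kappa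
  obtain ⟨hδM, hguess⟩ := hM.guessing
  have hδsub : ∀ x ∈ δ.ord.toZFSet, x ∈ (M : Set ZFSet.{u}) := fun x hx =>
    hsub (toZFSet_subset_toZFSet_iff.2 (ord_le_ord.2 hδ) hx)
  -- `α` is an ordinal in `M` that bounds `κ`, which need not be an element of `M`.
  have hκα : M.card.ord ≤ α := by
    by_contra! hlt
    exact hα fun x hx => hsub (toZFSet_subset_toZFSet_iff.2 hlt.le hx)
  have hbdd : ∀ o < δ.ord, ∀ x ⊆ o.toZFSet, x ∈ (M : Set ZFSet.{u}) := by
    intro o ho x hx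
    refine hMH.subset_mem hH (fun x hx => hsub hx) hαM hκα
      (hδsub _ (toZFSet_mem_toZFSet_iff.2 ho)) ?_ hx
    rw [card_toZFSet, card_ord]
    exact (le_powerlt 2 (lt_ord.1 ho)).trans h
  have hpow : ZFSet.powerset δ.ord.toZFSet ⊆ M := by
    intro x hx
    rw [ZFSet.mem_powerset] at hx
    obtain ⟨y, hyM, hy⟩ := hguess x (Set.mem_univ x) ⟨_, hδM, hx⟩ fun a ⟨b, hb, f, hf⟩ => by
      obtain ⟨β, hβ, hβb⟩ := mem_toZFSet_iff.1 hb
      have hcard : (δ.ord.toZFSet ∩ a.1).card < δ := by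
        refine (card_inter_le_of_satInjection hMH hH hf hδsub).trans_lt ?_
        rw [← hβb, card_toZFSet]
        exact lt_ord.1 hβ
      obtain ⟨o, ho, hao⟩ := hM.regular.exists_subset_toZFSet
        (fun z hz => (ZFSet.mem_inter.1 hz).1) hcard
      refine hbdd o ho _ fun z hz => hao ?_
      rw [ZFSet.mem_inter] at hz ⊢
      exact ⟨hx hz.1, hz.2⟩
    -- The guess agrees with `x` only on `M`; since `δ ⊆ M`, cutting it down to `δ` recovers `x`
    -- exactly.
    have hrestrict : y ∩ δ.ord.toZFSet = x := by
      ext z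
      rw [ZFSet.mem_inter]
      have hz : z ∈ y ∧ z ∈ M ↔ z ∈ x ∧ z ∈ M := Set.ext_iff.1 hy z
      constructor
      · exact fun h => (hz.1 ⟨h.1, hδsub _ h.2⟩).1
      · exact fun h => ⟨(hz.2 ⟨h, hδsub _ (hx h)⟩).1, hx h⟩
    exact hrestrict ▸ hMH.inter_mem hH hyM hδM
  simpa using ZFSet.card_mono hpow

theorem mainTheorem8 :
    (∀ δ κ : Cardinal.{u},
      (∃ M : ZFSet.{u}, IsGuessingElementarySubmodel (M : Set ZFSet.{u}) δ ∧
        M.card = κ ∧ κ < 2 ^ δ ∧ κ.ord.toZFSet ⊆ M) →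
      κ < Cardinal.powerlt 2 δ) ∧
    (∀ γ : Cardinal.{u},
      (∃ M : ZFSet.{u}, IsGuessingElementarySubmodel (M : Set ZFSet.{u}) (Order.succ γ) ∧
        M.card = Order.succ γ ∧ (Order.succ γ).ord.toZFSet ⊆ M) →
      Order.succ γ < 2 ^ γ) := by
  have main : ∀ δ κ : Cardinal.{u},
      (∃ M : ZFSet.{u}, IsGuessingElementarySubmodel (M : Set ZFSet.{u}) δ ∧
        M.card = κ ∧ κ < 2 ^ δ ∧ κ.ord.toZFSet ⊆ M) →
      κ < Cardinal.powerlt 2 δ := by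
    rintro δ κ ⟨M, hM, rfl, hlt, hsub⟩
    rcases lt_or_ge M.card δ with h | h
    · exact (cantor _).trans_le (le_powerlt 2 h)
    · by_contra! hle
      exact hlt.not_ge (hM.two_power_le hsub h hle)
  refine ⟨main, fun γ ⟨M, hM, hcard, hsub⟩ => ?_⟩
  -- For a successor, `2 ^< γ⁺ = 2 ^ γ`.
  rw [← powerlt_succ two_ne_zero]
  exact main _ _ ⟨M, hM, hcard, cantor _, hsub⟩
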